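/- Consider Herman's algorithm on a ring of $N\ge 1$ processors $1,\dots,N$, where the successor of processor $x$ is $x+1$ modulo $N$. At each time step, every processor that holds a token independently keeps it or passes it to the next processor, each with probability $\tfrac12$; all updates are simultaneous, and if a processor that keeps its token also receives one, then the two tokens annihilate each other. A state is stable if exactly one token remains. Let $A^{(0)},A^{(1)},\dots$ be the random sequence of states, started from a fixed state $A^{(0)}$ with an odd number of tokens. The step from time $t$ to time $t+1$ costs $\frac{m-1}{2}$ if $A^{(t)}$ has $m$ tokens; let $c_t$ be the cost accumulated by time $t$ (so $c_0=0$), and let $T$ be the earliest time at which the state is stable. Let $b_1<\dots<b_m$ be the positions of the tokens of $A^{(0)}$, and let $\boldsymbol a^{(0)}=(a_1,\dots,a_m)$ be the vector of gaps between consecutive tokens: $a_i=b_{i+1}-b_i$ for $i<m$ and $a_m=N+b_1-b_m$. For odd $m$ put $$\operatorname{steg}(a_1,\dots,a_m)=\sum_{\substack{1\le i<j<k\le m\\ j-i,\ k-j\ \text{odd}}}a_ia_ja_k ,$$ so that $\operatorname{steg}(a_1)=0$. Theorem. Almost surely $T<\infty$ and $c_t=c_T$ for all $t\ge T$. The total cost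 $c_T$ is integrable, and $$\mathbb E(c_T)=\frac4N\,\operatorname{steg}\bigl(\boldsymbol a^{(0)}\bigr).$$ -/

import Mathlib

open MeasureTheory

namespace Herman

/-- `steg (a₁, …, aₘ)`: the sum of all triples with even gaps, i.e. of the products
`aᵢ aⱼ aₖ` with `i < j < k` such that the number of unused indices strictly between
cyclically consecutive used ones is even. For odd `m` this says that `j - i` and `k - j`
are both odd (the third gap is then even automatically). -/
def steg {m : ℕ} (a : Fin m → ℝ) : ℝ :=
  ∑ i : Fin m, ∑ j : Fin m, ∑ k : Fin m,
    if i < j ∧ j < k ∧ Odd ((j : ℕ) - (i : ℕ)) ∧ Odd ((k : ℕ) - (j : ℕ)) then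
      a i * a j * a k
    else 0

/-- A state of the ring of `N` processors: the set of processors that hold a token.
The successor of processor `x` in the ring is `x + 1` (addition modulo `N`). -/
abbrev State (N : ℕ) : Type := Finset (Fin N)

/-- The vector of distances between consecutive tokens: with `b₁ < ⋯ < bₘ` the positions of
the tokens, the components are `bᵢ₊₁ - bᵢ` for `i < m`, and `N + b₁ - bₘ` for `i = m`. -/
def gaps {N : ℕ} (A : State N) (i : Fin A.card) : ℝ :=
  if h : (i : ℕ) + 1 < A.card then
    ((A.orderEmbOfFin rfl ⟨(i : ℕ) + 1, h⟩ : ℕ) : ℝ) - ((A.orderEmbOfFin rfl i : ℕ) : ℝ)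
  else
    (N : ℝ) + ((A.orderEmbOfFin rfl ⟨0, i.pos⟩ : ℕ) : ℝ) - ((A.orderEmbOfFin rfl i : ℕ) : ℝ)

/-- The state following `A` when exactly the processors in `P ⊆ A` pass their token to the
next processor and those in `A \ P` keep it. A kept token and a token received by the same
processor annihilate each other, hence the symmetric difference. -/
def move {N : ℕ} [NeZero N] (A P : State N) : State N :=
  symmDiff (A \ P) (P.image fun x => x + 1)

/-- The law of the state following `A`: each processor with a token independently keeps or
passes it with probability `1 / 2`, that is, the set `P` of processors that pass their token
is uniformly distributed among the subsets of `A`. -/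
noncomputable def stepLaw {N : ℕ} [NeZero N] (A : State N) : PMF (State N) :=
  (PMF.uniformOfFinset A.powerset ⟨∅, Finset.empty_mem_powerset A⟩).map (move A)

/-- `A 0, A 1, …` is a run of Herman's algorithm started at `A₀`: a Markov chain on the
states with initial state `A₀` and one-step transition probabilities `stepLaw`. -/
structure IsRun {N : ℕ} [NeZero N] {Ω : Type*} [MeasurableSpace Ω] (μ : Measure Ω)
    (A : ℕ → Ω → State N) (A₀ : State N) : Prop where
  measurable : ∀ (t : ℕ) (B : State N), MeasurableSet {ω | A t ω = B}
  start : ∀ᵐ ω ∂μ, A 0 ω = A₀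
  markov : ∀ (t : ℕ) (x : ℕ → State N),
    μ {ω | ∀ s ≤ t + 1, A s ω = x s} = μ {ω | ∀ s ≤ t, A s ω = x s} * stepLaw (x t) (x (t + 1))

/-- A state is stable if it has exactly one token. -/
def IsStable {N : ℕ} (A : State N) : Prop := A.card = 1

/-- The cost of a step taken from a state with `m` tokens is `(m - 1) / 2`. -/
noncomputable def stepCost {N : ℕ} (A : State N) : ℝ := ((A.card : ℝ) - 1) / 2

/-- The cost `c_t` accumulated by time `t`. -/
noncomputable def cost {N : ℕ} {Ω : Type*} (A : ℕ → Ω → State N) (t : ℕ) (ω : Ω) : ℝ :=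
  ∑ s ∈ Finset.range t, stepCost (A s ω)

/-- The stabilisation time: the earliest time at which the state is stable
(with value `0` if there is no such time). -/
noncomputable def stabTime {N : ℕ} {Ω : Type*} (A : ℕ → Ω → State N) (ω : Ω) : ℕ :=
  sInf {t | IsStable (A t ω)}

/-- The total cost: the cost accumulated until stabilisation. -/
noncomputable def totalCost {N : ℕ} {Ω : Type*} (A : ℕ → Ω → State N) (ω : Ω) : ℝ :=
  cost A (stabTime A ω) ω

end Herman

/-!
Unroll the ring along `ℕ` and attach to each position `k` the spin `(-1) ^ m`, where `m` is the
number of tokens on the arc `0, …, k - 1`. Since a gap counts ring positions, `steg` of the gap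
vector counts triples of positions such that the two arcs between consecutive ones carry an odd
number of tokens. The indicator of such a triple is a sum of terms that each involve only the
product of two of its spins. As an odd number of tokens makes the spins antiperiodic, summing over
all triples turns `steg` into an affine function of the autocorrelations of the spins, in which
the lag `d` has weight `N - 2 * d`.

In one step of the algorithm, up to a common sign, each spin becomes one of two neighbouring old
spins, with probability `1 / 2` each and independently for distinct processors. So the expected
autocorrelation satisfies a discrete heat equation in `d`. The weights are linear in `d`, hence
harmonic, and Green's identity leaves only boundary terms: the expectation of `steg` decreases by
`N / 4` times the cost of the step. Since `steg` is nonnegative and bounded by a multiple of the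
cost of the next step, this telescopes to the total cost.
-/

namespace Herman

open Finset

section Sequences

theorem sum_range_add_eq_of_periodic {M : Type*} [AddCommMonoid M] {f : ℕ → M} {n : ℕ}
    (hf : Function.Periodic f n) (a : ℕ) : ∑ k ∈ range n, f (k + a) = ∑ k ∈ range n, f k := by
  induction a with
  | zero => rfl
  | succ a ih =>
    rw [← ih]
    cases n with
    | zero => rfl
    | succ n =>
      rw [sum_range_succ, sum_range_succ' (fun k => f (k + a)),
        show n + (a + 1) = 0 + a + (n + 1) by lia, hf]
      simp only [add_right_comm, add_assoc]

variable {R : Type*} [CommRing R]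

theorem sum_range_sum_range_sub (g : ℕ → R) (n : ℕ) :
    ∑ v ∈ range n, ∑ u ∈ range v, (g v - g u) = ∑ u ∈ range n, (2 * u + 1 - n) * g u := by
  induction n with
  | zero => rfl
  | succ n ih =>
    have hstep (u : ℕ) : (2 * u + 1 - (n + 1 : ℕ)) * g u = (2 * u + 1 - n) * g u - g u := by
      push_cast
      ring
    rw [sum_range_succ, ih, sum_range_succ, sum_congr rfl fun u _ => hstep u, sum_sub_distrib,
      sum_sub_distrib, sum_const, card_range, nsmul_eq_mul]
    push_cast
    ring

theorem sum_triples_eq_sum_pairs (f : ℕ → ℕ → R) (n : ℕ) :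
    ∑ w ∈ range n, ∑ v ∈ range w, ∑ u ∈ range v, (f u v + f v w - f u w) =
      ∑ v ∈ range n, ∑ u ∈ range v, (n - 2 * (v - u)) * f u v := by
  induction n with
  | zero => rfl
  | succ n ih =>
    have hlast : ∑ v ∈ range n, ∑ u ∈ range v, (f u v + f v n - f u n) =
        ∑ v ∈ range n, ∑ u ∈ range v, f u v + ∑ u ∈ range n, (2 * u + 1 - n) * f u n := by
      rw [← sum_range_sum_range_sub fun u => f u n]
      simp only [← sum_add_distrib, add_sub_assoc]
    rw [sum_range_succ, ih, hlast, sum_range_succ, ← add_assoc, ← sum_add_distrib]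
    congr 1
    · refine sum_congr rfl fun v _ => ?_
      rw [← sum_add_distrib]
      refine sum_congr rfl fun u _ => ?_
      push_cast
      ring
    · refine sum_congr rfl fun u _ => ?_
      push_cast
      ring

/-- The correlation at lag `d` of a sequence with itself over a window of length `n`; when the
products `s u * s (u + d)` are `n`-periodic in `u`, the position of the window is irrelevant. -/
def autocorr (s : ℕ → R) (n d : ℕ) : R := ∑ u ∈ range n, s u * s (u + d)

variable {s : ℕ → R} {n : ℕ}

theorem periodic_mul_shift (hs : Function.Antiperiodic s n) (d : ℕ) :
    Function.Periodic (fun u => s u * s (u + d)) n := fun u => by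
  simp only [add_right_comm u n d, hs u, hs (u + d), neg_mul_neg]

theorem two_mul_sum_pairs_eq_sum_autocorr (hs : Function.Antiperiodic s n) :
    2 * ∑ v ∈ range n, ∑ u ∈ range v, ((n : R) - 2 * (v - u)) * (s u * s v) =
      ∑ d ∈ Ico 1 n, ((n : R) - 2 * d) * autocorr s n d := by
  set F : ℕ → ℕ → R := fun u v => ((n : R) - 2 * (v - u)) * (s u * s v) with hF
  have F_add_period (u v : ℕ) : F u (v + n) = F v u := by
    simp only [hF, hs v]
    push_cast
    ring
  have later (u : ℕ) (hu : u ∈ range n) : ∑ d ∈ Ico 1 n, F u (d + u) =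
      ∑ v ∈ Ico (u + 1) n, F u v + ∑ v ∈ range u, F v u := by
    have hu : u < n := mem_range.1 hu
    rw [sum_Ico_add' (F u), ← sum_Ico_consecutive (F u) (by lia : 1 + u ≤ n) (by lia : n ≤ n + u),
      add_comm 1 u, sum_Ico_eq_sum_range (F u) n, Nat.add_sub_cancel_left]
    simp only [add_comm n, F_add_period]
  have swap : ∑ u ∈ range n, ∑ v ∈ Ico (u + 1) n, F u v = ∑ v ∈ range n, ∑ u ∈ range v, F u v := by
    simp only [range_eq_Ico]
    exact sum_Ico_Ico_comm' 0 n F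
  calc 2 * ∑ v ∈ range n, ∑ u ∈ range v, F u v
      = ∑ u ∈ range n, (∑ v ∈ Ico (u + 1) n, F u v + ∑ v ∈ range u, F v u) := by
        rw [sum_add_distrib, swap, two_mul]
    _ = ∑ u ∈ range n, ∑ d ∈ Ico 1 n, F u (d + u) := (sum_congr rfl later).symm
    _ = ∑ d ∈ Ico 1 n, ((n : R) - 2 * d) * autocorr s n d := by
        rw [sum_comm]
        refine sum_congr rfl fun d _ => ?_
        rw [autocorr, mul_sum]
        refine sum_congr rfl fun u _ => ?_
        simp only [hF, add_comm u d]
        push_cast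
        ring

theorem sum_range_green (w c : ℕ → R) (n : ℕ) :
    ∑ d ∈ range n, (w (d + 1) * (c (d + 2) - 2 * c (d + 1) + c d) -
        c (d + 1) * (w (d + 2) - 2 * w (d + 1) + w d)) =
      (w n * c (n + 1) - w (n + 1) * c n) - (w 0 * c 1 - w 1 * c 0) := by
  rw [← sum_range_sub fun d => w d * c (d + 1) - w (d + 1) * c d]
  exact sum_congr rfl fun d _ => by ring

theorem autocorr_neg (s : ℕ → R) (n d : ℕ) : autocorr (fun u => -s u) n d = autocorr s n d := by
  simp only [autocorr, neg_mul_neg]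

theorem autocorr_shift (hs : Function.Antiperiodic s n) (a d : ℕ) :
    autocorr (fun u => s (u + a)) n d = autocorr s n d := by
  simp only [autocorr, ← sum_range_add_eq_of_periodic (periodic_mul_shift hs d) a,
    add_right_comm _ d]

theorem autocorr_zero (hs : ∀ u, s u ^ 2 = 1) : autocorr s n 0 = n := by
  simp [autocorr, ← sq, hs]

theorem autocorr_sub (hs : Function.Antiperiodic s n) {d : ℕ} (hd : d ≤ n) :
    autocorr s n (n - d) = -autocorr s n d := by
  rw [autocorr, ← sum_range_add_eq_of_periodic (periodic_mul_shift hs _) d, autocorr,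
    ← sum_neg_distrib]
  refine sum_congr rfl fun u _ => ?_
  rw [add_assoc, Nat.add_sub_cancel' hd, hs, mul_neg, mul_comm]

theorem sum_linear_mul_laplacian_autocorr (hs : Function.Antiperiodic s n)
    (hsq : ∀ u, s u ^ 2 = 1) (hn : n ≠ 0) :
    ∑ d ∈ Ico 1 n, ((n : R) - 2 * d) *
        (autocorr s n (d + 1) - 2 * autocorr s n d + autocorr s n (d - 1)) =
      2 * n * (n - 2 - autocorr s n 1) := by
  obtain ⟨m, rfl⟩ := Nat.exists_eq_add_one_of_ne_zero hn
  set C := autocorr s (m + 1)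
  let w : ℕ → R := fun d => (m + 1 : ℕ) - 2 * d
  have C_zero : C 0 = (m + 1 : ℕ) := autocorr_zero hsq
  have C_top : C (m + 1) = -C 0 := autocorr_sub hs m.succ.zero_le
  have C_pred : C m = -C 1 := autocorr_sub hs (Nat.succ_pos m)
  calc ∑ d ∈ Ico 1 (m + 1), w d * (C (d + 1) - 2 * C d + C (d - 1))
      = ∑ d ∈ range m, (w (d + 1) * (C (d + 2) - 2 * C (d + 1) + C d) -
          C (d + 1) * (w (d + 2) - 2 * w (d + 1) + w d)) := by
        rw [sum_Ico_eq_sum_range, Nat.add_sub_cancel]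
        refine sum_congr rfl fun d _ => ?_
        simp only [w, add_comm 1 d, Nat.add_sub_cancel, add_assoc]
        push_cast
        ring
    _ = (w m * C (m + 1) - w (m + 1) * C m) - (w 0 * C 1 - w 1 * C 0) := sum_range_green w C m
    _ = 2 * (m + 1 : ℕ) * ((m + 1 : ℕ) - 2 - C 1) := by
        simp only [w, C_top, C_pred, C_zero]
        push_cast
        ring

end Sequences

section Steg

theorem steg_nonneg {m : ℕ} {a : Fin m → ℝ} (ha : 0 ≤ a) : 0 ≤ steg a :=
  sum_nonneg fun i _ => sum_nonneg fun j _ => sum_nonneg fun k _ =>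
    ite_nonneg (mul_nonneg (mul_nonneg (ha i) (ha j)) (ha k)) le_rfl

theorem steg_of_lt_three {m : ℕ} (hm : m < 3) (a : Fin m → ℝ) : steg a = 0 :=
  sum_eq_zero fun i _ => sum_eq_zero fun j _ => sum_eq_zero fun k _ => if_neg (by lia)

theorem sum_card_fiber_mul {ι : Type*} {S : Finset ι} {τ : ι → ℕ} {m : ℕ}
    (hτ : ∀ x ∈ S, τ x < m) (g : ℕ → ℝ) :
    ∑ i : Fin m, (#{x ∈ S | τ x = i} : ℝ) * g i = ∑ x ∈ S, g (τ x) := by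
  rw [Fin.sum_univ_eq_sum_range fun i => (#{x ∈ S | τ x = i} : ℝ) * g i,
    ← sum_fiberwise_of_maps_to' fun x hx => mem_range.2 (hτ x hx)]
  simp only [sum_const, nsmul_eq_mul]

theorem steg_card_fiber {ι : Type*} {S : Finset ι} {τ : ι → ℕ} {m : ℕ} (hτ : ∀ x ∈ S, τ x < m) :
    steg (fun i : Fin m => (#{x ∈ S | τ x = i} : ℝ)) =
      ∑ x ∈ S, ∑ y ∈ S, ∑ z ∈ S,
        if τ x < τ y ∧ τ y < τ z ∧ Odd (τ y - τ x) ∧ Odd (τ z - τ y) then 1 else 0 := by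
  let indicator (i j k : ℕ) : ℝ := if i < j ∧ j < k ∧ Odd (j - i) ∧ Odd (k - j) then 1 else 0
  calc steg (fun i : Fin m => (#{x ∈ S | τ x = i} : ℝ))
      = ∑ i : Fin m, (#{x ∈ S | τ x = i} : ℝ) * ∑ j : Fin m, (#{y ∈ S | τ y = j} : ℝ) *
          ∑ k : Fin m, (#{z ∈ S | τ z = k} : ℝ) * indicator i j k := by
        simp only [steg, indicator, mul_sum, mul_ite, mul_one, mul_zero, mul_assoc, Fin.lt_def]
    _ = ∑ x ∈ S, ∑ y ∈ S, ∑ z ∈ S, indicator (τ x) (τ y) (τ z) := by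
        simp only [fun i j => sum_card_fiber_mul hτ (indicator i j),
          fun i => sum_card_fiber_mul hτ fun j => ∑ z ∈ S, indicator i j (τ z),
          sum_card_fiber_mul hτ fun i => ∑ y ∈ S, ∑ z ∈ S, indicator i (τ y) (τ z)]

theorem steg_card_fiber_of_monotone {τ : ℕ → ℕ} (hmono : Monotone τ) {m n : ℕ}
    (hτ : ∀ x < n, τ x < m) :
    steg (fun i : Fin m => (#{x ∈ range n | τ x = i} : ℝ)) =
      ∑ w ∈ range n, ∑ v ∈ range w, ∑ u ∈ range v,
        if Odd (τ v - τ u) ∧ Odd (τ w - τ v) then 1 else 0 := by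
  rw [steg_card_fiber fun x hx => hτ x (mem_range.1 hx), sum_comm_cycle]
  refine sum_congr rfl fun w hw => ?_
  rw [sum_comm]
  have hw : w < n := mem_range.1 hw
  refine (sum_subset_zero_on_sdiff (range_mono hw.le) (fun v hv => ?_) fun v hv => ?_).symm
  · exact sum_eq_zero fun u _ => if_neg fun h =>
      (mem_sdiff.1 hv).2 (mem_range.2 (hmono.reflect_lt h.2.1))
  have hv : v < w := mem_range.1 hv
  refine sum_subset_zero_on_sdiff (range_mono (hv.trans hw).le) (fun u hu => ?_) fun u hu => ?_
  · exact if_neg fun h => (mem_sdiff.1 hu).2 (mem_range.2 (hmono.reflect_lt h.1))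
  -- An odd difference is nonzero, which makes the two inequalities strict.
  refine if_congr ?_ rfl rfl
  have := hmono hv.le
  have := hmono (mem_range.1 hu).le
  grind

theorem four_mul_ite_odd {i j k : ℕ} (hij : i ≤ j) (hjk : j ≤ k) :
    4 * (if Odd (j - i) ∧ Odd (k - j) then 1 else 0 : ℝ) =
      (1 - (-1) ^ i * (-1) ^ j) + (1 - (-1) ^ j * (-1) ^ k) - (1 - (-1) ^ i * (-1) ^ k) := by
  obtain ⟨a, rfl⟩ := Nat.exists_eq_add_of_le hij
  obtain ⟨b, rfl⟩ := Nat.exists_eq_add_of_le hjk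
  simp only [Nat.add_sub_cancel_left, pow_add]
  rcases neg_one_pow_eq_or ℝ i with hi | hi <;> rcases Nat.even_or_odd a with ha | ha <;>
    rcases Nat.even_or_odd b with hb | hb <;>
    simp [hi, ha.neg_one_pow, hb.neg_one_pow, ha, hb] <;> norm_num

theorem sum_range_choose_eq_choose_succ (n k : ℕ) :
    ∑ v ∈ range n, v.choose k = n.choose (k + 1) := by
  induction n with
  | zero => rfl
  | succ n ih => rw [sum_range_succ, ih, add_comm, Nat.choose_succ_succ']

theorem sum_range_sum_range_linear (n : ℕ) :
    ∑ v ∈ range n, ∑ u ∈ range v, ((n : ℝ) - 2 * (v - u)) = n.choose 3 := by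
  have count : ∑ w ∈ range n, ∑ v ∈ range w, ∑ _u ∈ range v, 1 = n.choose 3 := by
    simp only [← sum_range_choose_eq_choose_succ, Nat.choose_zero_right]
  have := sum_triples_eq_sum_pairs (fun _ _ => (1 : ℝ)) n
  simp only [add_sub_cancel_right, mul_one] at this
  rw [← this, ← count]
  push_cast
  rfl

theorem steg_card_fiber_of_antiperiodic {τ : ℕ → ℕ} (hmono : Monotone τ) {m n : ℕ}
    (hτ : ∀ x < n, τ x < m) (hanti : Function.Antiperiodic (fun x => (-1 : ℝ) ^ τ x) n) :
    steg (fun i : Fin m => (#{x ∈ range n | τ x = i} : ℝ)) =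
      (n.choose 3 -
        (∑ d ∈ Ico 1 n, ((n : ℝ) - 2 * d) * autocorr (fun x => (-1 : ℝ) ^ τ x) n d) / 2) / 4 := by
  set ε : ℕ → ℝ := fun x => (-1) ^ τ x
  have four_mul_steg : 4 * steg (fun i : Fin m => (#{x ∈ range n | τ x = i} : ℝ)) =
      ∑ v ∈ range n, ∑ u ∈ range v, ((n : ℝ) - 2 * (v - u)) * (1 - ε u * ε v) := by
    rw [steg_card_fiber_of_monotone hmono hτ, ← sum_triples_eq_sum_pairs]
    simp only [mul_sum]
    refine sum_congr rfl fun w _ => sum_congr rfl fun v hv => sum_congr rfl fun u hu => ?_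
    exact four_mul_ite_odd (hmono (mem_range.1 hu).le) (hmono (mem_range.1 hv).le)
  simp only [mul_sub, mul_one, sum_sub_distrib] at four_mul_steg
  rw [← two_mul_sum_pairs_eq_sum_autocorr hanti]
  simp only [← sum_range_sum_range_linear, mul_sub, sum_sub_distrib] at four_mul_steg ⊢
  linarith

end Steg

section TokenSign

open scoped BigOperators

variable {N : ℕ}

/-- The factor that processor `x` contributes to the sign of an arc through it. -/
def tokenSign (A : State N) (x : Fin N) : ℝ := if x ∈ A then -1 else 1

theorem tokenSign_mul_self (A : State N) (x : Fin N) : tokenSign A x * tokenSign A x = 1 := by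
  rw [tokenSign]
  split_ifs <;> norm_num

theorem expect_powerset_prod {ι K : Type*} [Field K] [CharZero K] (S : Finset ι)
    (g : ι → K) : 𝔼 P ∈ S.powerset, ∏ p ∈ P, g p = ∏ p ∈ S, (1 + g p) / 2 := by
  classical
  rw [expect_eq_sum_div_card, ← prod_one_add, card_powerset, prod_div_distrib, prod_const]
  norm_cast

theorem expect_tokenSign_mul_tokenSign (A : State N) {x y : Fin N} (hxy : x ≠ y) :
    𝔼 P ∈ A.powerset, tokenSign P x * tokenSign P y =
      (1 + tokenSign A x) / 2 * ((1 + tokenSign A y) / 2) := by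
  have tokenSign_eq_prod (P : State N) (z : Fin N) :
      tokenSign P z = ∏ p ∈ P, if p = z then (-1 : ℝ) else 1 :=
    (prod_ite_eq' P z fun _ => (-1 : ℝ)).symm
  have half_one_add (S : State N) (z : Fin N) :
      (1 + tokenSign S z) / 2 = ∏ p ∈ S, if p = z then (0 : ℝ) else 1 := by
    rw [prod_ite_eq', tokenSign]
    split_ifs <;> norm_num
  simp only [half_one_add]
  simp only [tokenSign_eq_prod, ← prod_mul_distrib, expect_powerset_prod]
  refine prod_congr rfl fun p _ => ?_
  by_cases hx : p = x <;> by_cases hy : p = y <;> simp_all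

end TokenSign

section Unrolling

variable {N : ℕ} [NeZero N] {A : State N}

/-- The ring unrolled along `ℕ`: `k` is read as the processor with index `k` modulo `N`. -/
abbrev Occupied (A : State N) (k : ℕ) : Prop := Fin.ofNat N k ∈ A

/-- The sign `(-1) ^ m` of the arc `0, …, k - 1` of the unrolled ring, `m` being its number of
tokens. -/
noncomputable def spin (A : State N) (k : ℕ) : ℝ := (-1) ^ Nat.count (Occupied A) k

theorem occupied_add_period (A : State N) (k : ℕ) : Occupied A (N + k) ↔ Occupied A k := by
  simp [Occupied, Fin.ofNat]

theorem ofNat_add_one (k : ℕ) : Fin.ofNat N (k + 1) = Fin.ofNat N k + 1 := by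
  simp [Fin.ext_iff, Fin.ofNat, Fin.val_add]

theorem ofNat_ne_ofNat {u v : ℕ} (huv : u < v) (hvu : v < u + N) :
    Fin.ofNat N u ≠ Fin.ofNat N v := fun h => by
  have dvd := Nat.dvd_of_mod_eq_zero (Nat.sub_mod_eq_zero_of_mod_eq (congrArg Fin.val h).symm)
  have := Nat.le_of_dvd (by lia) dvd
  lia

theorem sum_range_ofNat {M : Type*} [AddCommMonoid M] (f : Fin N → M) :
    ∑ k ∈ range N, f (Fin.ofNat N k) = ∑ x, f x := by
  rw [← Fin.sum_univ_eq_sum_range]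
  simp only [Fin.ofNat_val_eq_self]

theorem count_occupied_period (A : State N) : Nat.count (Occupied A) N = A.card := by
  rw [Nat.count_eq_card_filter_range, card_filter, sum_range_ofNat fun x => if x ∈ A then 1 else 0,
    ← card_filter, filter_univ_mem]

theorem count_occupied_add_period (A : State N) (k : ℕ) :
    Nat.count (Occupied A) (N + k) = A.card + Nat.count (Occupied A) k := by
  simp only [Nat.count_add, count_occupied_period, occupied_add_period]

theorem spin_sq (A : State N) (k : ℕ) : spin A k ^ 2 = 1 := by
  rw [spin, pow_right_comm, neg_one_sq, one_pow]

theorem spin_succ (A : State N) (k : ℕ) :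
    spin A (k + 1) = spin A k * tokenSign A (Fin.ofNat N k) := by
  rw [spin, Nat.count_succ, pow_add, ← spin, tokenSign]
  split_ifs <;> simp

theorem spin_antiperiodic (hA : Odd A.card) : Function.Antiperiodic (spin A) N := fun k => by
  rw [spin, add_comm, count_occupied_add_period, pow_add, hA.neg_one_pow, neg_one_mul, spin]

theorem autocorr_spin_one (A : State N) : autocorr (spin A) N 1 = N - 2 * A.card := by
  have sum_tokenSign : ∑ x, tokenSign A x = N - 2 * A.card := by
    have (x : Fin N) : tokenSign A x = 1 - 2 * if x ∈ A then 1 else 0 := by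
      rw [tokenSign]
      split_ifs <;> norm_num
    simp [this, sum_sub_distrib, mul_comm]
  rw [autocorr, ← sum_tokenSign, ← sum_range_ofNat]
  refine sum_congr rfl fun k _ => ?_
  rw [spin_succ, ← mul_assoc, ← sq, spin_sq, one_mul]

theorem infinite_occupied (hA : A.Nonempty) : (Set.ofPred (Occupied A)).Infinite := by
  obtain ⟨x, hx⟩ := hA
  refine Set.infinite_of_injective_forall_mem (f := fun j : ℕ => N * j + x) (fun i j h => ?_)
    fun j => ?_
  · simpa [NeZero.ne N] using h
  · simpa [Occupied, Fin.ofNat, Nat.mod_eq_of_lt x.2] using hx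

theorem orderEmbOfFin_eq_nth (A : State N) (i : Fin A.card) :
    (A.orderEmbOfFin rfl i : ℕ) = Nat.nth (Occupied A) i := by
  have lt (i : Fin A.card) : Nat.nth (Occupied A) i < N :=
    Nat.nth_lt_of_lt_count (by rw [count_occupied_period]; exact i.2)
  have inf := infinite_occupied (card_pos.1 i.pos)
  have mem (i : Fin A.card) : (⟨_, lt i⟩ : Fin N) ∈ A := by
    simpa only [Occupied, Fin.ofNat, Nat.mod_eq_of_lt (lt i)] using Nat.nth_mem_of_infinite inf i
  rw [← orderEmbOfFin_unique rfl mem fun i j h => Nat.nth_strictMono inf h]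

theorem nth_card (hA : A.Nonempty) :
    Nat.nth (Occupied A) A.card = N + Nat.nth (Occupied A) 0 := by
  have inf := infinite_occupied hA
  have occupied : Occupied A (N + Nat.nth (Occupied A) 0) :=
    (occupied_add_period A _).2 (Nat.nth_mem_of_infinite inf 0)
  rw [← Nat.nth_count occupied, count_occupied_add_period, Nat.count_nth_of_infinite inf, add_zero]

theorem gaps_eq_nth_sub_nth (A : State N) (i : Fin A.card) :
    gaps A i = (Nat.nth (Occupied A) (i + 1) : ℝ) - Nat.nth (Occupied A) i := by
  rw [gaps]
  split_ifs with h
  · simp only [orderEmbOfFin_eq_nth]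
  · have : (i : ℕ) + 1 = A.card := by lia
    rw [this, nth_card (card_pos.1 i.pos)]
    simp only [orderEmbOfFin_eq_nth]
    push_cast
    rfl

/-- The number of tokens met on the `k` processors following the first token `b₁`. -/
noncomputable def tokensPastFirst (A : State N) (k : ℕ) : ℕ :=
  Nat.count (fun j => Occupied A (Nat.nth (Occupied A) 0 + 1 + j)) k

theorem one_add_tokensPastFirst (hA : A.Nonempty) (k : ℕ) :
    1 + tokensPastFirst A k = Nat.count (Occupied A) (Nat.nth (Occupied A) 0 + 1 + k) := by
  have inf := infinite_occupied hA
  rw [tokensPastFirst, Nat.count_add, Nat.count_succ, Nat.count_nth_of_infinite inf,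
    if_pos (Nat.nth_mem_of_infinite inf 0), zero_add]

theorem tokensPastFirst_mono (A : State N) : Monotone (tokensPastFirst A) := Nat.count_monotone _

theorem tokensPastFirst_eq_iff (hA : A.Nonempty) (k i : ℕ) :
    tokensPastFirst A k = i ↔
      Nat.nth (Occupied A) i ≤ Nat.nth (Occupied A) 0 + k ∧
        Nat.nth (Occupied A) 0 + k < Nat.nth (Occupied A) (i + 1) := by
  have lt_count_iff (j : ℕ) := Nat.lt_nth_iff_count_lt (infinite_occupied hA) (a := j)
    (b := Nat.nth (Occupied A) 0 + 1 + k)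
  have h1 := lt_count_iff i
  have h2 := lt_count_iff (i + 1)
  rw [← one_add_tokensPastFirst hA] at h1 h2
  lia

theorem gaps_eq_card (A : State N) (i : Fin A.card) :
    gaps A i = #{x ∈ range N | tokensPastFirst A x = i} := by
  have hA : A.Nonempty := card_pos.1 i.pos
  have mono := (Nat.nth_strictMono (infinite_occupied hA)).monotone
  have zero_le := mono (Nat.zero_le i)
  have le_succ := mono (Nat.le_succ i)
  have le_card := mono (Nat.succ_le_of_lt i.2)
  rw [nth_card hA] at le_card
  have fiber : {x ∈ range N | tokensPastFirst A x = i} =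
      Ico (Nat.nth (Occupied A) i - Nat.nth (Occupied A) 0)
        (Nat.nth (Occupied A) (i + 1) - Nat.nth (Occupied A) 0) := by
    ext x
    rw [mem_filter, mem_range, tokensPastFirst_eq_iff hA, mem_Ico]
    lia
  rw [gaps_eq_nth_sub_nth, fiber, Nat.card_Ico, tsub_tsub_tsub_cancel_right zero_le,
    Nat.cast_sub le_succ]

theorem steg_gaps_nonneg (A : State N) : 0 ≤ steg (gaps A) :=
  steg_nonneg fun i => by rw [gaps_eq_card]; exact Nat.cast_nonneg _

theorem tokensPastFirst_lt (hA : A.Nonempty) {x : ℕ} (hx : x < N) :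
    tokensPastFirst A x < A.card := by
  have mono := Nat.count_monotone (Occupied A)
    (by lia : Nat.nth (Occupied A) 0 + 1 + x ≤ N + Nat.nth (Occupied A) 0)
  rw [← one_add_tokensPastFirst hA, count_occupied_add_period,
    Nat.count_nth_of_infinite (infinite_occupied hA)] at mono
  lia

theorem neg_one_pow_tokensPastFirst (hA : A.Nonempty) (k : ℕ) :
    (-1) ^ tokensPastFirst A k = -spin A (k + (Nat.nth (Occupied A) 0 + 1)) := by
  rw [spin, add_comm k, ← one_add_tokensPastFirst hA, pow_add, pow_one, neg_one_mul, neg_neg]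

theorem steg_gaps_eq (hA : Odd A.card) :
    steg (gaps A) =
      (N.choose 3 - (∑ d ∈ Ico 1 N, ((N : ℝ) - 2 * d) * autocorr (spin A) N d) / 2) / 4 := by
  have hne : A.Nonempty := card_pos.1 hA.pos
  have signs := funext (neg_one_pow_tokensPastFirst hne)
  have hanti := spin_antiperiodic hA
  rw [funext (gaps_eq_card A), steg_card_fiber_of_antiperiodic (tokensPastFirst_mono A)
    (fun x hx => tokensPastFirst_lt hne hx), signs]
  · simp only [autocorr_neg, autocorr_shift hanti]
  · simp only [signs]
    exact fun k => congrArg Neg.neg (hanti.add_const _ k)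

end Unrolling

section OneStep

open scoped BigOperators

variable {N : ℕ} [NeZero N] {A P : State N}

theorem tokenSign_move (hP : P ⊆ A) (x : Fin N) :
    tokenSign (move A P) (x + 1) =
      tokenSign A (x + 1) * tokenSign P (x + 1) * tokenSign P x := by
  have mem_move : x + 1 ∈ move A P ↔ (x + 1 ∈ A ∧ x + 1 ∉ P ↔ x ∉ P) := by
    simp only [move, mem_symmDiff, mem_sdiff, mem_image, add_left_inj, exists_eq_right]
    tauto
  have := @hP (x + 1)
  simp only [tokenSign, mem_move]
  by_cases h1 : x + 1 ∈ A <;> by_cases h2 : x + 1 ∈ P <;> by_cases h3 : x ∈ P <;> simp_all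

theorem spin_move_mul_spin_move (hP : P ⊆ A) {u v : ℕ} (huv : u ≤ v) :
    spin (move A P) (u + 1) * spin (move A P) (v + 1) =
      spin A (u + 1) * spin A (v + 1) *
        (tokenSign P (Fin.ofNat N u) * tokenSign P (Fin.ofNat N v)) := by
  induction v, huv using Nat.le_induction with
  | base => rw [tokenSign_mul_self, mul_one, ← sq, ← sq, spin_sq, spin_sq]
  | succ v _ ih =>
    calc spin (move A P) (u + 1) * spin (move A P) (v + 1 + 1)
        = spin A (u + 1) * (spin A (v + 1) * tokenSign A (Fin.ofNat N (v + 1))) *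
            (tokenSign P (Fin.ofNat N u) * tokenSign P (Fin.ofNat N (v + 1))) *
            (tokenSign P (Fin.ofNat N v) * tokenSign P (Fin.ofNat N v)) := by
          rw [spin_succ _ (v + 1), ← mul_assoc, ih, ofNat_add_one, tokenSign_move hP]
          ring
      _ = spin A (u + 1) * spin A (v + 1 + 1) *
            (tokenSign P (Fin.ofNat N u) * tokenSign P (Fin.ofNat N (v + 1))) := by
          rw [tokenSign_mul_self, mul_one, spin_succ A (v + 1)]

theorem card_move_add (hP : P ⊆ A) :
    (move A P).card + 2 * ((A \ P) ∩ P.image (· + 1)).card = A.card := by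
  have card_passed : (P.image (· + 1)).card = P.card :=
    card_image_of_injective _ (add_left_injective 1)
  have card_kept := card_sdiff_add_card_eq_card hP
  have card_move : (move A P).card = _ := card_union_of_disjoint disjoint_sdiff_sdiff
  have h1 := card_sdiff_add_card_inter (A \ P) (P.image (· + 1))
  have h2 := card_sdiff_add_card_inter (P.image (· + 1)) (A \ P)
  rw [inter_comm] at h2
  lia

theorem odd_card_move (hP : P ⊆ A) (hA : Odd A.card) : Odd (move A P).card := by
  have := card_move_add hP
  grind

theorem IsStable.move (hA : IsStable A) (hP : P ⊆ A) : IsStable (move A P) := by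
  have := card_move_add hP
  rw [IsStable] at hA ⊢
  lia

theorem expect_spin_move_mul_spin_move (A : State N) {u v : ℕ} (huv : u < v) (hvu : v < u + N) :
    𝔼 P ∈ A.powerset, spin (move A P) (u + 1) * spin (move A P) (v + 1) =
      (spin A u + spin A (u + 1)) * (spin A v + spin A (v + 1)) / 4 := by
  have spin_succ_mul (k : ℕ) : spin A (k + 1) * tokenSign A (Fin.ofNat N k) = spin A k := by
    rw [spin_succ, mul_assoc, tokenSign_mul_self, mul_one]
  rw [expect_congr rfl fun P hP => spin_move_mul_spin_move (mem_powerset.1 hP) huv.le, ← mul_expect,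
    expect_tokenSign_mul_tokenSign A (ofNat_ne_ofNat huv hvu), ← spin_succ_mul u, ← spin_succ_mul v]
  ring

theorem expect_autocorr_spin_move (hA : Odd A.card) {d : ℕ} (hd : d ∈ Ico 1 N) :
    𝔼 P ∈ A.powerset, autocorr (spin (move A P)) N d =
      (autocorr (spin A) N (d + 1) + 2 * autocorr (spin A) N d + autocorr (spin A) N (d - 1)) /
        4 := by
  obtain ⟨hd0, hdN⟩ := mem_Ico.1 hd
  obtain ⟨e, rfl⟩ := Nat.exists_eq_add_of_le' hd0
  have hanti := spin_antiperiodic hA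
  have window (d : ℕ) :
      ∑ u ∈ range N, spin A (u + 1) * spin A (u + (d + 1)) = autocorr (spin A) N d := by
    rw [autocorr, ← sum_range_add_eq_of_periodic (periodic_mul_shift hanti d) 1]
    simp only [add_assoc, add_comm 1 d]
  calc 𝔼 P ∈ A.powerset, autocorr (spin (move A P)) N (e + 1)
      = 𝔼 P ∈ A.powerset, ∑ u ∈ range N,
          spin (move A P) (u + 1) * spin (move A P) (u + (e + 1) + 1) := by
        refine expect_congr rfl fun P hP => ?_
        have := spin_antiperiodic (odd_card_move (mem_powerset.1 hP) hA)
        rw [autocorr, ← sum_range_add_eq_of_periodic (periodic_mul_shift this _) 1]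
        simp only [add_right_comm _ 1 (e + 1)]
    _ = ∑ u ∈ range N, (spin A u + spin A (u + 1)) *
          (spin A (u + (e + 1)) + spin A (u + (e + 1) + 1)) / 4 := by
        rw [expect_sum_comm]
        exact sum_congr rfl fun u _ => expect_spin_move_mul_spin_move A (by lia) (by lia)
    _ = (autocorr (spin A) N (e + 1 + 1) + 2 * autocorr (spin A) N (e + 1) +
          autocorr (spin A) N e) / 4 := by
        have expand (u : ℕ) : (spin A u + spin A (u + 1)) *
              (spin A (u + (e + 1)) + spin A (u + (e + 1) + 1)) =
            spin A u * spin A (u + (e + 1 + 1)) + spin A u * spin A (u + (e + 1)) +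
              spin A (u + 1) * spin A (u + (e + 1 + 1)) +
              spin A (u + 1) * spin A (u + (e + 1)) := by
          rw [← add_assoc u (e + 1) 1]
          ring
        simp only [← sum_div, expand, sum_add_distrib, window]
        simp only [autocorr]
        ring

theorem expect_steg_gaps_move (hA : Odd A.card) :
    𝔼 P ∈ A.powerset, steg (gaps (move A P)) = steg (gaps A) - N / 4 * stepCost A := by
  have heat :
      ∑ d ∈ Ico 1 N, ((N : ℝ) - 2 * d) * 𝔼 P ∈ A.powerset, autocorr (spin (move A P)) N d =
      ∑ d ∈ Ico 1 N, ((N : ℝ) - 2 * d) * autocorr (spin A) N d + N * (A.card - 1) := by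
    have green := sum_linear_mul_laplacian_autocorr (spin_antiperiodic hA) (spin_sq A)
      (NeZero.ne N)
    rw [autocorr_spin_one] at green
    rw [← sub_eq_iff_eq_add', ← sum_sub_distrib, show (N : ℝ) * (A.card - 1) =
      2 * N * (N - 2 - (N - 2 * A.card)) / 4 by ring, ← green, sum_div]
    refine sum_congr rfl fun d hd => ?_
    rw [expect_autocorr_spin_move hA hd]
    ring
  rw [expect_congr rfl fun P hP => steg_gaps_eq (odd_card_move (mem_powerset.1 hP) hA),
    ← expect_div, expect_sub_distrib, ← expect_div, expect_sum_comm,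
    expect_const A.powerset_nonempty]
  simp only [← mul_expect, heat]
  rw [steg_gaps_eq hA, stepCost]
  ring

end OneStep

open Filter Topology in
theorem hasSum_of_forall_succ_eq_sub {k e : ℕ → ℝ} (hk : ∀ n, 0 ≤ k n) (he : ∀ n, 0 ≤ e n)
    (step : ∀ n, e (n + 1) = e n - k n) {C : ℝ} (hle : ∀ n, e n ≤ C * k n) :
    HasSum k (e 0) := by
  have partial_sum (n : ℕ) : ∑ i ∈ range n, k i = e 0 - e n := by
    rw [← sum_range_sub' e]
    exact sum_congr rfl fun i _ => by rw [step]; ring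
  have summable : Summable k := summable_of_sum_range_le hk fun n => by
    rw [partial_sum]
    exact sub_le_self _ (he n)
  have lim : Tendsto e atTop (𝓝 0) := by
    refine squeeze_zero he hle ?_
    simpa using summable.tendsto_atTop_zero.const_mul C
  rw [hasSum_iff_tendsto_nat_of_nonneg hk]
  simpa only [partial_sum, sub_zero] using lim.const_sub (e 0)

section Probability

open Filter
open scoped BigOperators

variable {Ω E : Type*} [MeasurableSpace Ω] {μ : Measure Ω} [NormedAddCommGroup E] {ι : Type*}
  {f : ι → Ω → E}

theorem tsum_lintegral_enorm_ne_top (hf : ∀ i, Integrable (f i) μ)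
    (hsum : Summable fun i => ∫ ω, ‖f i ω‖ ∂μ) : ∑' i, ∫⁻ ω, ‖f i ω‖ₑ ∂μ ≠ ⊤ := by
  simp only [← ofReal_integral_norm_eq_lintegral_enorm (hf _)]
  exact hsum.tsum_ofReal_ne_top

theorem ae_summable_norm [Countable ι] (hf : ∀ i, Integrable (f i) μ)
    (hsum : Summable fun i => ∫ ω, ‖f i ω‖ ∂μ) : ∀ᵐ ω ∂μ, Summable fun i => ‖f i ω‖ := by
  refine summable_norm_of_tsum_eLpNorm_ne_top le_rfl (fun i => (hf i).1) ?_
  simpa only [eLpNorm_one_eq_lintegral_enorm] using tsum_lintegral_enorm_ne_top hf hsum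

theorem integrable_tsum [Countable ι] [CompleteSpace E] (hf : ∀ i, Integrable (f i) μ)
    (hsum : Summable fun i => ∫ ω, ‖f i ω‖ ∂μ) : Integrable (fun ω => ∑' i, f i ω) μ := by
  refine ⟨aestronglyMeasurable_of_tendsto_ae (u := atTop) (f := fun s ω => ∑ i ∈ s, f i ω)
    (fun s => s.aestronglyMeasurable_fun_sum fun i _ => (hf i).1) ?_, ?_⟩
  · filter_upwards [ae_summable_norm hf hsum] with ω hω using hω.of_norm.hasSum
  · calc ∫⁻ ω, ‖∑' i, f i ω‖ₑ ∂μ ≤ ∫⁻ ω, ∑' i, ‖f i ω‖ₑ ∂μ :=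
          lintegral_mono fun ω => enorm_tsum_le_tsum_enorm
      _ = ∑' i, ∫⁻ ω, ‖f i ω‖ₑ ∂μ := lintegral_tsum fun i => (hf i).1.enorm
      _ < ⊤ := (tsum_lintegral_enorm_ne_top hf hsum).lt_top

theorem sum_toReal_map_uniformOfFinset_mul {α β : Type*} [Finite α] [Fintype β]
    {s : Finset α} (hs : s.Nonempty) (g : α → β) (f : β → ℝ) :
    ∑ b, ((PMF.uniformOfFinset s hs).map g b).toReal * f b = 𝔼 a ∈ s, f (g a) := by
  have := Fintype.ofFinite α
  let _ : MeasurableSpace α := ⊤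
  let _ : MeasurableSpace β := ⊤
  calc ∑ b, ((PMF.uniformOfFinset s hs).map g b).toReal * f b
      = ∫ a, f (g a) ∂(PMF.uniformOfFinset s hs).toMeasure := by
        simp only [← smul_eq_mul, ← PMF.integral_eq_sum]
        rw [← PMF.toMeasure_map g _ measurable_from_top, integral_map (by fun_prop) (by fun_prop)]
    _ = 𝔼 a ∈ s, f (g a) := by
        rw [PMF.integral_eq_sum, expect_eq_sum_div_card, sum_div, ← sum_subset s.subset_univ]
        · refine sum_congr rfl fun a ha => ?_
          rw [PMF.uniformOfFinset_apply_of_mem hs ha, ENNReal.toReal_inv, ENNReal.toReal_natCast,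
            smul_eq_mul, inv_mul_eq_div]
        · intro a _ ha
          rw [PMF.uniformOfFinset_apply_of_notMem hs ha, ENNReal.toReal_zero, zero_smul]

theorem sum_measure_preimage_singleton_inter {Ω β : Type*} [MeasurableSpace Ω] {μ : Measure Ω}
    [Fintype β] [MeasurableSpace β] [MeasurableSingletonClass β] {X : Ω → β} (hX : Measurable X)
    (S : Set Ω) : ∑ b, μ (X ⁻¹' {b} ∩ S) = μ S := by
  have meas (b : β) : MeasurableSet (X ⁻¹' {b}) := hX (measurableSet_singleton b)
  simpa [Measure.restrict_apply, meas] using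
    sum_measure_preimage_singleton (μ := μ.restrict S) univ fun b _ => meas b

theorem integral_comp_eq_sum {Ω β : Type*} [MeasurableSpace Ω]
    {μ : Measure Ω} [IsFiniteMeasure μ] [Fintype β] [MeasurableSpace β]
    [MeasurableSingletonClass β] {X : Ω → β} (hX : Measurable X)
    (f : β → ℝ) :
    ∫ ω, f (X ω) ∂μ = ∑ b, μ.real (X ⁻¹' {b}) * f b := by
  rw [← integral_map hX.aemeasurable (by fun_prop), integral_fintype .of_finite]
  simp only [map_measureReal_apply hX (measurableSet_singleton _), smul_eq_mul]

end Probability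

section StepCost

variable {N : ℕ} {A : State N}

theorem stepCost_nonneg (hA : Odd A.card) : 0 ≤ stepCost A := by
  have : (1 : ℝ) ≤ A.card := by exact_mod_cast hA.pos
  rw [stepCost]
  linarith

theorem one_le_stepCost (hA : Odd A.card) (h : ¬ IsStable A) : 1 ≤ stepCost A := by
  have card : 3 ≤ A.card := by
    rw [IsStable] at h
    grind
  have : (3 : ℝ) ≤ A.card := by exact_mod_cast card
  rw [stepCost]
  linarith

theorem IsStable.stepCost_eq_zero (h : IsStable A) : stepCost A = 0 := by
  rw [stepCost, h, Nat.cast_one, sub_self, zero_div]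

theorem exists_steg_gaps_le_mul_stepCost (N : ℕ) [NeZero N] :
    ∃ C : ℝ, ∀ A : State N, Odd A.card → steg (gaps A) ≤ C * stepCost A := by
  refine ⟨∑ B : State N, steg (gaps B), fun A hA => ?_⟩
  by_cases hs : IsStable A
  · rw [hs.stepCost_eq_zero, mul_zero, steg_of_lt_three (by rw [hs]; norm_num)]
  · calc steg (gaps A) ≤ ∑ B : State N, steg (gaps B) :=
          single_le_sum (f := fun B : State N => steg (gaps B)) (fun B _ => steg_gaps_nonneg B)
            (mem_univ A)
      _ ≤ (∑ B : State N, steg (gaps B)) * stepCost A :=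
          le_mul_of_one_le_right (sum_nonneg fun B _ => steg_gaps_nonneg B) (one_le_stepCost hA hs)

end StepCost

section StepLaw

open scoped BigOperators

variable {N : ℕ} [NeZero N]

theorem sum_toReal_stepLaw_mul (A : State N) (f : State N → ℝ) :
    ∑ B, (stepLaw A B).toReal * f B = 𝔼 P ∈ A.powerset, f (move A P) :=
  sum_toReal_map_uniformOfFinset_mul _ (move A) f

theorem exists_eq_move_of_stepLaw_ne_zero {A B : State N} (h : stepLaw A B ≠ 0) :
    ∃ P ⊆ A, B = move A P := by
  obtain ⟨P, hP, rfl⟩ := (PMF.mem_support_map_iff _ _ _).1 ((PMF.mem_support_iff _ _).2 h)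
  exact ⟨P, mem_powerset.1 ((PMF.mem_support_uniformOfFinset_iff _ _).1 hP), rfl⟩

end StepLaw

namespace IsRun

open Filter
open scoped BigOperators

variable {N : ℕ} [NeZero N] {Ω : Type*} [MeasurableSpace Ω] {μ : Measure Ω}
  {A : ℕ → Ω → State N} {A₀ : State N}

theorem measurable_state (hA : IsRun μ A A₀) (t : ℕ) : Measurable (A t) :=
  measurable_to_countable' (hA.measurable t)

theorem measure_transition (hA : IsRun μ A A₀) (t : ℕ) (B C : State N) :
    μ {ω | A t ω = B ∧ A (t + 1) ω = C} = μ {ω | A t ω = B} * stepLaw B C := by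
  let path (h : Fin t → State N) (s : ℕ) : State N :=
    if hs : s < t then h ⟨s, hs⟩ else if s = t then B else C
  let history (ω : Ω) (s : Fin t) : State N := A s ω
  have agree_iff (h : Fin t → State N) (ω : Ω) :
      (∀ s ≤ t, A s ω = path h s) ↔ history ω = h ∧ A t ω = B := by
    simp only [path, history, funext_iff, Fin.forall_iff]
    grind
  have agree_succ_iff (h : Fin t → State N) (ω : Ω) :
      (∀ s ≤ t + 1, A s ω = path h s) ↔ history ω = h ∧ A t ω = B ∧ A (t + 1) ω = C := by
    simp only [path, history, funext_iff, Fin.forall_iff]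
    grind
  have measurable_history : Measurable history :=
    measurable_pi_lambda _ fun s => hA.measurable_state s
  have markov (h : Fin t → State N) :
      μ (history ⁻¹' {h} ∩ {ω | A t ω = B ∧ A (t + 1) ω = C}) =
        μ (history ⁻¹' {h} ∩ {ω | A t ω = B}) * stepLaw B C := by
    have path_t : path h t = B := by simp [path]
    have path_succ : path h (t + 1) = C := by simp [path]
    have := hA.markov t (path h)
    simp only [agree_iff, agree_succ_iff, path_t, path_succ] at this
    exact this
  rw [← sum_measure_preimage_singleton_inter measurable_history {ω | A t ω = B ∧ A (t + 1) ω = C},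
    ← sum_measure_preimage_singleton_inter measurable_history {ω | A t ω = B}, sum_mul]
  exact sum_congr rfl fun h _ => markov h

theorem ae_exists_eq_move (hA : IsRun μ A A₀) :
    ∀ᵐ ω ∂μ, ∀ t, ∃ P ⊆ A t ω, A (t + 1) ω = move (A t ω) P := by
  have ae_stepLaw_ne_zero (t : ℕ) (B C : State N) :
      ∀ᵐ ω ∂μ, A t ω = B ∧ A (t + 1) ω = C → stepLaw B C ≠ 0 := by
    by_cases h : stepLaw B C = 0
    · have null : μ {ω | A t ω = B ∧ A (t + 1) ω = C} = 0 := by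
        rw [hA.measure_transition, h, mul_zero]
      filter_upwards [measure_eq_zero_iff_ae_notMem.1 null] with ω hω hBC using absurd hBC hω
    · exact .of_forall fun ω _ => h
  simp only [← ae_all_iff] at ae_stepLaw_ne_zero
  filter_upwards [ae_stepLaw_ne_zero] with ω hω t
  exact exists_eq_move_of_stepLaw_ne_zero (hω t _ _ ⟨rfl, rfl⟩)

theorem ae_odd_card (hA : IsRun μ A A₀) (hA₀ : Odd A₀.card) :
    ∀ᵐ ω ∂μ, ∀ t, Odd (A t ω).card := by
  filter_upwards [hA.ae_exists_eq_move, hA.start] with ω hmove hstart t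
  induction t with
  | zero => rwa [hstart]
  | succ t ih =>
    obtain ⟨P, hP, next⟩ := hmove t
    rw [next]
    exact odd_card_move hP ih

theorem ae_isStable_of_le (hA : IsRun μ A A₀) :
    ∀ᵐ ω ∂μ, ∀ s, IsStable (A s ω) → ∀ t ≥ s, IsStable (A t ω) := by
  filter_upwards [hA.ae_exists_eq_move] with ω hmove s hs t ht
  induction t, ht using Nat.le_induction with
  | base => exact hs
  | succ t _ ih =>
    obtain ⟨P, hP, next⟩ := hmove t
    rw [next]
    exact ih.move hP

theorem ae_stepCost_nonneg (hA : IsRun μ A A₀) (hA₀ : Odd A₀.card) :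
    ∀ᵐ ω ∂μ, ∀ t, 0 ≤ stepCost (A t ω) := by
  filter_upwards [hA.ae_odd_card hA₀] with ω hodd t using stepCost_nonneg (hodd t)

theorem integral_norm_stepCost (hA : IsRun μ A A₀) (hA₀ : Odd A₀.card) (t : ℕ) :
    ∫ ω, ‖stepCost (A t ω)‖ ∂μ = ∫ ω, stepCost (A t ω) ∂μ := by
  refine integral_congr_ae ?_
  filter_upwards [hA.ae_stepCost_nonneg hA₀] with ω h using Real.norm_of_nonneg (h t)

variable [IsProbabilityMeasure μ]

theorem integrable_comp (hA : IsRun μ A A₀) (t : ℕ) (f : State N → ℝ) :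
    Integrable (fun ω => f (A t ω)) μ :=
  Integrable.of_finite.comp_measurable (hA.measurable_state t)

theorem integral_comp_succ (hA : IsRun μ A A₀) (t : ℕ) (f : State N → ℝ) :
    ∫ ω, f (A (t + 1) ω) ∂μ = ∫ ω, 𝔼 P ∈ (A t ω).powerset, f (move (A t ω) P) ∂μ := by
  have total_probability (C : State N) : μ.real (A (t + 1) ⁻¹' {C}) =
      ∑ B, μ.real (A t ⁻¹' {B}) * (stepLaw B C).toReal := by
    rw [measureReal_def, ← sum_measure_preimage_singleton_inter (hA.measurable_state t),
      ENNReal.toReal_sum fun B _ => measure_ne_top μ _]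
    exact sum_congr rfl fun B _ => by
      rw [measureReal_def, ← ENNReal.toReal_mul]
      exact congrArg _ (hA.measure_transition t B C)
  rw [integral_comp_eq_sum (hA.measurable_state (t + 1)),
    integral_comp_eq_sum (hA.measurable_state t) fun B => 𝔼 P ∈ B.powerset, f (move B P)]
  simp only [total_probability, ← sum_toReal_stepLaw_mul, sum_mul, mul_sum, mul_assoc]
  exact sum_comm

theorem integral_steg_gaps_succ (hA : IsRun μ A A₀) (hA₀ : Odd A₀.card) (t : ℕ) :
    ∫ ω, steg (gaps (A (t + 1) ω)) ∂μ =
      ∫ ω, steg (gaps (A t ω)) ∂μ - N / 4 * ∫ ω, stepCost (A t ω) ∂μ := by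
  rw [hA.integral_comp_succ t fun B => steg (gaps B), ← integral_const_mul, ← integral_sub
    (hA.integrable_comp t fun B => steg (gaps B)) ((hA.integrable_comp t stepCost).const_mul _)]
  refine integral_congr_ae ?_
  filter_upwards [hA.ae_odd_card hA₀] with ω hodd using expect_steg_gaps_move (hodd t)

theorem hasSum_integral_stepCost (hA : IsRun μ A A₀) (hA₀ : Odd A₀.card) :
    HasSum (fun t => ∫ ω, stepCost (A t ω) ∂μ) (4 / N * steg (gaps A₀)) := by
  have hN : (N : ℝ) ≠ 0 := NeZero.ne _
  obtain ⟨C, hC⟩ := exists_steg_gaps_le_mul_stepCost N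
  have le (t : ℕ) : ∫ ω, steg (gaps (A t ω)) ∂μ ≤ C * ∫ ω, stepCost (A t ω) ∂μ := by
    rw [← integral_const_mul]
    refine integral_mono_ae (hA.integrable_comp t fun B => steg (gaps B))
      ((hA.integrable_comp t stepCost).const_mul C) ?_
    filter_upwards [hA.ae_odd_card hA₀] with ω hodd using hC _ (hodd t)
  have start : ∫ ω, steg (gaps (A 0 ω)) ∂μ = steg (gaps A₀) := by
    have : (fun ω => steg (gaps (A 0 ω))) =ᵐ[μ] fun _ => steg (gaps A₀) := by
      filter_upwards [hA.start] with ω h using by rw [h]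
    rw [integral_congr_ae this, integral_const, probReal_univ, one_smul]
  have nonneg (t : ℕ) : 0 ≤ ∫ ω, stepCost (A t ω) ∂μ := integral_nonneg_of_ae <| by
    filter_upwards [hA.ae_stepCost_nonneg hA₀] with ω h using h t
  have scaled := hasSum_of_forall_succ_eq_sub (k := fun t => N / 4 * ∫ ω, stepCost (A t ω) ∂μ)
    (fun t => mul_nonneg (by positivity) (nonneg t))
    (fun t => integral_nonneg fun ω => steg_gaps_nonneg (A t ω))
    (hA.integral_steg_gaps_succ hA₀) (C := 4 / N * C) fun t => (le t).trans_eq (by field_simp)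
  rw [start] at scaled
  have cancel : 4 / (N : ℝ) * (N / 4) = 1 := by field_simp
  simpa only [← mul_assoc, cancel, one_mul] using scaled.mul_left (4 / (N : ℝ))

theorem summable_integral_norm_stepCost (hA : IsRun μ A A₀) (hA₀ : Odd A₀.card) :
    Summable fun t => ∫ ω, ‖stepCost (A t ω)‖ ∂μ := by
  simpa only [hA.integral_norm_stepCost hA₀] using (hA.hasSum_integral_stepCost hA₀).summable

theorem ae_exists_isStable (hA : IsRun μ A A₀) (hA₀ : Odd A₀.card) :
    ∀ᵐ ω ∂μ, ∃ t, IsStable (A t ω) := by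
  filter_upwards [hA.ae_odd_card hA₀, ae_summable_norm (fun t => hA.integrable_comp t stepCost)
    (hA.summable_integral_norm_stepCost hA₀)] with ω hodd hsum
  obtain ⟨t, ht⟩ := (hsum.of_norm.tendsto_atTop_zero.eventually_lt_const one_pos).exists
  exact ⟨t, by_contra fun h => ht.not_ge (one_le_stepCost (hodd t) h)⟩

theorem ae_stepCost_eq_zero_of_stabTime_le (hA : IsRun μ A A₀) (hA₀ : Odd A₀.card) :
    ∀ᵐ ω ∂μ, ∀ t ≥ stabTime A ω, stepCost (A t ω) = 0 := by
  filter_upwards [hA.ae_exists_isStable hA₀, hA.ae_isStable_of_le] with ω hex hstable t ht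
  exact (hstable _ (Nat.sInf_mem hex) t ht).stepCost_eq_zero

theorem ae_cost_eq_totalCost (hA : IsRun μ A A₀) (hA₀ : Odd A₀.card) :
    ∀ᵐ ω ∂μ, ∀ t ≥ stabTime A ω, cost A t ω = totalCost A ω := by
  filter_upwards [hA.ae_stepCost_eq_zero_of_stabTime_le hA₀] with ω hzero t ht
  exact (sum_subset (range_mono ht) fun s _ hs => hzero s (by simpa using hs)).symm

theorem totalCost_ae_eq_tsum (hA : IsRun μ A A₀) (hA₀ : Odd A₀.card) :
    totalCost A =ᵐ[μ] fun ω => ∑' t, stepCost (A t ω) := by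
  filter_upwards [hA.ae_stepCost_eq_zero_of_stabTime_le hA₀] with ω hzero
  exact (tsum_eq_sum (s := range (stabTime A ω)) fun s hs =>
    hzero s (by simpa using hs)).symm

end IsRun

end Herman

theorem mainTheorem2 {N : ℕ} [NeZero N] (A₀ : Herman.State N) (hA₀ : Odd A₀.card)
    {Ω : Type*} [MeasurableSpace Ω] (μ : Measure Ω) [IsProbabilityMeasure μ]
    (A : ℕ → Ω → Herman.State N) (hA : Herman.IsRun μ A A₀) :
    (∀ᵐ ω ∂μ, (∃ t, Herman.IsStable (A t ω)) ∧
      ∀ t ≥ Herman.stabTime A ω, Herman.cost A t ω = Herman.totalCost A ω) ∧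
    Integrable (Herman.totalCost A) μ ∧
    ∫ ω, Herman.totalCost A ω ∂μ = 4 / (N : ℝ) * Herman.steg (Herman.gaps A₀) := by
  have integrable (t : ℕ) := hA.integrable_comp t Herman.stepCost
  have summable := hA.summable_integral_norm_stepCost hA₀
  have series := hA.totalCost_ae_eq_tsum hA₀
  refine ⟨(hA.ae_exists_isStable hA₀).and (hA.ae_cost_eq_totalCost hA₀),
    (Herman.integrable_tsum integrable summable).congr series.symm, ?_⟩
  calc ∫ ω, Herman.totalCost A ω ∂μ
      = ∫ ω, ∑' t, Herman.stepCost (A t ω) ∂μ := integral_congr_ae series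
    _ = ∑' t, ∫ ω, Herman.stepCost (A t ω) ∂μ :=
        (integral_tsum_of_summable_integral_norm integrable summable).symm
    _ = 4 / (N : ℝ) * Herman.steg (Herman.gaps A₀) := (hA.hasSum_integral_stepCost hA₀).tsum_eq
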